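/- Let $\ell\in\mathbb{Z}\setminus\{0\}$ and $\varepsilon\in\mathbb{R}\setminus\{0\}$, let $\mathbb{T}=\mathbb{R}/2\pi\mathbb{Z}$, and equip the torus $\mathbb{T}^2$ with coordinates $(x,y)$ with the smooth Lorentzian metric $g=2\,dx\,dy-\varepsilon\sin(\ell x)\,dy^2$. Then $|\det g|^{1/2}=1$, so that the volume measure of $g$ is $dx\,dy$, and the Laplace--Beltrami operator $$\Box_g f=|\det g|^{-1/2}\sum_{i,j}\partial_i\bigl(|\det g|^{1/2}g^{ij}\partial_j f\bigr)$$ is given on $C^\infty(\mathbb{T}^2)=C^\infty(\mathbb{T}^2;\mathbb{C})$ by $$\Box_g=\varepsilon\,\partial_x\bigl(\sin(\ell x)\,\partial_x\bigr)+2\,\partial_x\partial_y .$$ The operator $\Box_g$ in the Hilbert space $L^2(\mathbb{T}^2,dx\,dy)$ with domain $C^\infty(\mathbb{T}^2)$ is not essentially self-adjoint, that is, its closure is not self-adjoint. Moreover, there is a nonzero $w\in L^2(\mathbb{T}^2)$ with $(\Box_g-i)w=0$ in the sense of distributions, that is, $\int_{\mathbb{T}^2}w\,(\Box_g\varphi-i\varphi)\,dx\,dy=0$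 for all $\varphi\in C^\infty(\mathbb{T}^2)$. -/

import Mathlib

open Real MeasureTheory
open scoped ContDiff

noncomputable section

namespace LorentzTorus

instance fact_two_pi_pos : Fact ((0 : ℝ) < 2 * π) := ⟨Real.two_pi_pos⟩

/-- The circle `ℝ / 2πℤ`, with Mathlib's measure `dx` of total mass `2π`. -/
abbrev Circ : Type := AddCircle (2 * π)

/-- The two-torus with coordinates `(x, y)`, with the product measure `dx dy`. -/
abbrev Torus : Type := Circ × Circ

/-- The covering map `ℝ² → 𝕋²`. -/
def proj (v : ℝ × ℝ) : Torus := ((v.1 : Circ), (v.2 : Circ))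

/-- A function on the torus is smooth if its doubly periodic lift to `ℝ²` is smooth. -/
def IsSmooth {E : Type} [NormedAddCommGroup E] [NormedSpace ℝ E] (f : Torus → E) : Prop :=
  ContDiff ℝ ∞ (fun v : ℝ × ℝ => f (proj v))

/-- The space `C^∞(𝕋²)` of smooth complex-valued functions. -/
def SmoothFn : Submodule ℂ (Torus → ℂ) where
  carrier := {f | IsSmooth f}
  zero_mem' := by
    change ContDiff ℝ ∞ (fun _ : ℝ × ℝ => (0 : ℂ))
    exact contDiff_const
  add_mem' {f h} hf hh := by
    change ContDiff ℝ ∞ (fun v : ℝ × ℝ => f (proj v) + h (proj v))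
    exact ContDiff.add hf hh
  smul_mem' c f hf := by
    change ContDiff ℝ ∞ (fun v : ℝ × ℝ => c • f (proj v))
    exact ContDiff.const_smul c hf

/-- The translation vectors `(t, 0)` (for `i = 0`) and `(0, t)` (for `i = 1`) on the torus. -/
def shift (i : Fin 2) (t : ℝ) : Torus := ![((t : Circ), 0), (0, (t : Circ))] i

/-- The partial derivatives `∂_x = pderiv 0` and `∂_y = pderiv 1` of a function on the torus. -/
def pderiv (i : Fin 2) (f : Torus → ℂ) (p : Torus) : ℂ :=
  deriv (fun t : ℝ => f (p + shift i t)) 0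

/-- A Lorentzian metric on the torus, through its coefficients in the global frame
`∂_x, ∂_y`. In dimension two, a symmetric matrix has signature `(1, 1)` exactly when its
determinant is negative. -/
structure LorentzianMetric where
  coeff : Torus → Matrix (Fin 2) (Fin 2) ℝ
  smooth : ∀ i j, IsSmooth (fun p => coeff p i j)
  symm : ∀ p, (coeff p).IsSymm
  lorentzian : ∀ p, (coeff p).det < 0

/-- The volume density `|det g|^{1/2}` with respect to `dx dy`. -/
def LorentzianMetric.density (g : LorentzianMetric) (p : Torus) : ℝ :=
  √|(g.coeff p).det|

/-- The Laplace–Beltrami expression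
`|det g|^{-1/2} ∑_{i,j} ∂_i (|det g|^{1/2} g^{ij} ∂_j f)`. -/
def lbExpr (g : LorentzianMetric) (f : Torus → ℂ) (p : Torus) : ℂ :=
  ((g.density p)⁻¹ : ℝ) *
    ∑ i : Fin 2, ∑ j : Fin 2,
      pderiv i (fun q => ((g.density q * (g.coeff q)⁻¹ i j : ℝ) : ℂ) * pderiv j f q) p

/-! Smoothness of the Laplace–Beltrami expression of a smooth function. -/

/-- The coordinate vectors of `ℝ²`. -/
def vec (i : Fin 2) : ℝ × ℝ := ![((1 : ℝ), (0 : ℝ)), (0, 1)] i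

lemma proj_surjective (p : Torus) : ∃ v, proj v = p := by
  obtain ⟨⟨x⟩, ⟨y⟩⟩ := p
  exact ⟨(x, y), rfl⟩

lemma proj_add_smul (v : ℝ × ℝ) (i : Fin 2) (t : ℝ) :
    proj (v + t • vec i) = proj v + shift i t := by
  fin_cases i <;> simp [proj, shift, vec]

lemma hasDerivAt_shift {f : Torus → ℂ} (hf : IsSmooth f) (i : Fin 2) (v : ℝ × ℝ) :
    HasDerivAt (fun t : ℝ => f (proj v + shift i t))
      (fderiv ℝ (fun w : ℝ × ℝ => f (proj w)) v (vec i)) 0 := by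
  have h1 : HasFDerivAt (fun w : ℝ × ℝ => f (proj w))
      (fderiv ℝ (fun w : ℝ × ℝ => f (proj w)) v) (v + (0 : ℝ) • vec i) := by
    rw [zero_smul, add_zero]
    exact ((show ContDiff ℝ ∞ _ from hf).differentiable (by simp) v).hasFDerivAt
  have h2 : HasDerivAt (fun t : ℝ => v + t • vec i) (vec i) 0 := by
    simpa using ((hasDerivAt_id (0 : ℝ)).smul_const (vec i)).const_add v
  have h3 := h1.comp_hasDerivAt (0 : ℝ) h2
  refine h3.congr_of_eventuallyEq (Filter.Eventually.of_forall fun t => ?_)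
  simp [proj_add_smul]

lemma pderiv_proj {f : Torus → ℂ} (hf : IsSmooth f) (i : Fin 2) (v : ℝ × ℝ) :
    pderiv i f (proj v) = fderiv ℝ (fun w : ℝ × ℝ => f (proj w)) v (vec i) :=
  (hasDerivAt_shift hf i v).deriv

lemma IsSmooth.pderiv {f : Torus → ℂ} (hf : IsSmooth f) (i : Fin 2) :
    IsSmooth (pderiv i f) := by
  unfold IsSmooth
  simp only [pderiv_proj hf]
  exact ((show ContDiff ℝ ∞ _ from hf).fderiv_right (m := ∞) (by simp)).clm_apply contDiff_const

lemma pderiv_add {f h : Torus → ℂ} (hf : IsSmooth f) (hh : IsSmooth h) (i : Fin 2) (p : Torus) :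
    pderiv i (fun q => f q + h q) p = pderiv i f p + pderiv i h p := by
  obtain ⟨v, rfl⟩ := proj_surjective p
  exact deriv_fun_add (hasDerivAt_shift hf i v).differentiableAt
    (hasDerivAt_shift hh i v).differentiableAt

lemma pderiv_smul {f : Torus → ℂ} (hf : IsSmooth f) (c : ℂ) (i : Fin 2) (p : Torus) :
    pderiv i (fun q => c * f q) p = c * pderiv i f p := by
  obtain ⟨v, rfl⟩ := proj_surjective p
  exact deriv_const_mul c (hasDerivAt_shift hf i v).differentiableAt

lemma IsSmooth.ofReal {f : Torus → ℝ} (hf : IsSmooth f) : IsSmooth (fun p => (f p : ℂ)) :=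
  Complex.ofRealCLM.contDiff.comp hf

lemma LorentzianMetric.smooth_det (g : LorentzianMetric) : IsSmooth (fun p => (g.coeff p).det) := by
  unfold IsSmooth
  simp only [Matrix.det_fin_two]
  exact (ContDiff.mul (g.smooth 0 0) (g.smooth 1 1)).sub
    (ContDiff.mul (g.smooth 0 1) (g.smooth 1 0))

lemma LorentzianMetric.density_pos (g : LorentzianMetric) (p : Torus) : 0 < g.density p :=
  Real.sqrt_pos.2 (abs_pos.2 (g.lorentzian p).ne)

lemma LorentzianMetric.smooth_density (g : LorentzianMetric) : IsSmooth g.density := by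
  unfold IsSmooth LorentzianMetric.density
  simp only [fun p => abs_of_neg (g.lorentzian p)]
  exact (ContDiff.neg g.smooth_det).sqrt fun v => (neg_pos.2 (g.lorentzian _)).ne'

lemma LorentzianMetric.smooth_inv (g : LorentzianMetric) (i j : Fin 2) :
    IsSmooth (fun p => (g.coeff p)⁻¹ i j) := by
  have hd : ContDiff ℝ ∞ (fun v => ((g.coeff (proj v)).det)⁻¹) :=
    ContDiff.inv g.smooth_det fun v => (g.lorentzian _).ne
  unfold IsSmooth
  simp only [Matrix.inv_def, Ring.inverse_eq_inv', Matrix.adjugate_fin_two, Matrix.smul_apply,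
    smul_eq_mul]
  refine hd.mul ?_
  fin_cases i <;> fin_cases j
  · exact g.smooth 1 1
  · exact ContDiff.neg (g.smooth 0 1)
  · exact ContDiff.neg (g.smooth 1 0)
  · exact g.smooth 0 0

lemma smooth_flux (g : LorentzianMetric) {f : Torus → ℂ} (hf : IsSmooth f) (i j : Fin 2) :
    IsSmooth (fun q => ((g.density q * (g.coeff q)⁻¹ i j : ℝ) : ℂ) * pderiv j f q) :=
  ContDiff.mul (IsSmooth.ofReal (f := fun q => g.density q * (g.coeff q)⁻¹ i j)
    (ContDiff.mul g.smooth_density (g.smooth_inv i j))) (hf.pderiv j)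

lemma smooth_lbExpr (g : LorentzianMetric) {f : Torus → ℂ} (hf : IsSmooth f) :
    IsSmooth (lbExpr g f) := by
  refine ContDiff.mul (IsSmooth.ofReal (f := fun p => (g.density p)⁻¹) ?_) ?_
  · exact ContDiff.inv g.smooth_density fun v => (g.density_pos _).ne'
  · exact ContDiff.sum fun i _ => ContDiff.sum fun j _ => (smooth_flux g hf i j).pderiv i

/-- The Laplace–Beltrami operator `□_g` on `C^∞(𝕋²)`. -/
def laplaceBeltrami (g : LorentzianMetric) : SmoothFn →ₗ[ℂ] SmoothFn where
  toFun f := ⟨lbExpr g f, smooth_lbExpr g f.2⟩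
  map_add' f h := by
    ext p
    have hf : IsSmooth (f : Torus → ℂ) := f.2
    have hh : IsSmooth (h : Torus → ℂ) := h.2
    have e : ∀ j q, pderiv j ((f : Torus → ℂ) + h) q = pderiv j f q + pderiv j h q :=
      fun j q => pderiv_add hf hh j q
    simp only [lbExpr, Submodule.coe_add, Pi.add_apply, e, mul_add,
      pderiv_add (smooth_flux g hf _ _) (smooth_flux g hh _ _), Finset.sum_add_distrib]
  map_smul' c f := by
    ext p
    have hf : IsSmooth (f : Torus → ℂ) := f.2
    have e : ∀ j q, pderiv j (c • (f : Torus → ℂ)) q = c * pderiv j f q :=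
      fun j q => pderiv_smul hf c j q
    simp only [lbExpr, Submodule.coe_smul, Pi.smul_apply, e, mul_left_comm _ c,
      pderiv_smul (smooth_flux g hf _ _), ← Finset.mul_sum, smul_eq_mul, RingHom.id_apply]

/-! Operators in `L²(𝕋²)` with domain `C^∞(𝕋²)`. -/

/-- The Hilbert space `L²(𝕋², dx dy)`. -/
abbrev L2 : Type := Lp ℂ 2 (volume : Measure Torus)

lemma IsSmooth.continuous {f : Torus → ℂ} (hf : IsSmooth f) : Continuous f := by
  have hq : IsOpenQuotientMap (fun x : ℝ => (x : Circ)) :=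
    QuotientAddGroup.isOpenQuotientMap_mk
  exact (hq.prodMap hq).continuous_comp_iff.1 (ContDiff.continuous hf)

/-- Smooth functions as continuous functions. -/
def toContinuous : SmoothFn →ₗ[ℂ] C(Torus, ℂ) where
  toFun f := ⟨f, IsSmooth.continuous f.2⟩
  map_add' _ _ := rfl
  map_smul' _ _ := rfl

/-- The inclusion `C^∞(𝕋²) → L²(𝕋²)`. -/
def toL2 : SmoothFn →ₗ[ℂ] L2 :=
  (ContinuousMap.toLp 2 (volume : Measure Torus) ℂ).toLinearMap ∘ₗ toContinuous

lemma toL2_injective : Function.Injective toL2 := by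
  intro f h hfh
  have := ContinuousMap.toLp_injective (p := 2) (𝕜 := ℂ) (volume : Measure Torus) hfh
  exact Subtype.ext (congrArg (fun k : C(Torus, ℂ) => (k : Torus → ℂ)) this)

/-- A linear map `A` on `C^∞(𝕋²)`, regarded as an unbounded operator in `L²(𝕋²)` with
domain `C^∞(𝕋²)`. -/
def smoothOperator (A : SmoothFn →ₗ[ℂ] SmoothFn) : L2 →ₗ.[ℂ] L2 where
  domain := LinearMap.range toL2
  toFun := toL2 ∘ₗ A ∘ₗ (LinearEquiv.ofInjective toL2 toL2_injective).symm.toLinearMap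

/-- An unbounded operator is essentially self-adjoint if its closure is self-adjoint. If the
operator is not closable, then Mathlib's closure is the operator itself, which is then not
self-adjoint, since self-adjoint operators are closed. -/
def IsEssentiallySelfAdjoint {H : Type} [NormedAddCommGroup H] [InnerProductSpace ℂ H]
    [CompleteSpace H] (T : H →ₗ.[ℂ] H) : Prop :=
  IsSelfAdjoint T.closure

/-- `w ∈ L²(𝕋²)` solves `(□_g - z) w = 0` in the sense of distributions on the torus, with
respect to the volume density of `g`, for which `□_g` is its own formal transpose. -/
def IsWeakEigenfunction (g : LorentzianMetric) (z : ℂ) (w : L2) : Prop :=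
  ∀ φ : SmoothFn,
    ∫ p : Torus, w p * ((laplaceBeltrami g φ : Torus → ℂ) p - z * (φ : Torus → ℂ) p)
      * (g.density p : ℂ) = 0

/-! The metric `2 dx dy - ε sin(ℓ x) dy²`. -/

/-- The function `x ↦ sin(ℓ x)` on the circle, for an integer `ℓ`. -/
def sinMul (ℓ : ℤ) (x : Circ) : ℝ := Real.sin_periodic.lift (ℓ • x)

lemma sinMul_coe (ℓ : ℤ) (x : ℝ) : sinMul ℓ (x : Circ) = Real.sin (ℓ * x) := by
  unfold sinMul
  rw [← AddCircle.coe_zsmul, zsmul_eq_mul]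
  exact Real.sin_periodic.lift_coe _

/-- The Lorentzian metric `g = 2 dx dy - ε sin(ℓ x) dy²`. -/
def sinMetric (ℓ : ℤ) (ε : ℝ) : LorentzianMetric where
  coeff p := !![0, 1; 1, -(ε * sinMul ℓ p.1)]
  smooth i j := by
    unfold IsSmooth
    fin_cases i <;> fin_cases j
    · exact contDiff_const
    · exact contDiff_const
    · exact contDiff_const
    · simp only [proj, sinMul_coe]
      simp
      fun_prop
  symm p := by
    ext i j
    fin_cases i <;> fin_cases j <;> rfl
  lorentzian p := by simp [Matrix.det_fin_two]

end LorentzTorus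

end

/-!
After separating variables, a solution `w = u(x)` of `(□_g - i) w = 0` that does not depend on `y`
has to satisfy `ε (sin(ℓx) u')' = i u` on the circle, an equation that degenerates at the zeros of
`sin(ℓx)`. With `u = ∑_{n ≥ 1} (d_n / n) e^{inℓx}` and `K = ε ℓ² / 2`, it turns into the recurrence
`d_{n+1} = d_{n-1} - d_n / (K n²)`, `d_0 = 0`: the factor `n` produced by the outer derivative
makes the equation at `n = 0` void, so that the series may be supported on `n ≥ 1`.
The recurrence is a summable perturbation of `d_{n+1} = d_{n-1}`, hence `d` is bounded
(`exists_abs_amp_le`), `d_n / n` is square summable and `u` lies in `L²`; it is nonzero since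
`d_1 = 1`.

That `u` is a weak solution is checked on partial sums. Integrating by parts against a test
function `φ` expresses the pairing through the coefficients `φ̂(n) = ∫ e^{inℓx} φ dx dy`
(`waveIntegral_laplaceBeltrami`), and by the recurrence the sum telescopes (`sum_amp_eq`) to
boundary terms `d_N (N + 1) φ̂(N + 1) + d_{N+1} N φ̂(N)`, which tend to `0` since `φ` is smooth
(`tendsto_mul_waveIntegral`).

Finally, the complex conjugate of `w` is a nonzero vector orthogonal to the range of `□_g - i` on
smooth functions, hence to that of the closure; if the closure were self-adjoint, it would be
symmetric with eigenvalue `-i`, which is impossible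
(`not_isEssentiallySelfAdjoint_of_range_orthogonal`).
-/

/-! ### Calculus on the torus -/

namespace LorentzTorus

open scoped ComplexConjugate

lemma IsSmooth.mul {f h : Torus → ℂ} (hf : IsSmooth f) (hh : IsSmooth h) :
    IsSmooth (fun p => f p * h p) :=
  ContDiff.mul hf hh

lemma IsSmooth.const_mul {f : Torus → ℂ} (hf : IsSmooth f) (c : ℂ) : IsSmooth (fun p => c * f p) :=
  ContDiff.mul contDiff_const hf

lemma shift_zero (i : Fin 2) : shift i 0 = 0 := by
  fin_cases i <;> simp [shift]

lemma shift_add (i : Fin 2) (s t : ℝ) : shift i (s + t) = shift i s + shift i t := by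
  fin_cases i <;> simp [shift]

lemma pderiv_mul {f h : Torus → ℂ} (hf : IsSmooth f) (hh : IsSmooth h) (i : Fin 2) (p : Torus) :
    pderiv i (fun q => f q * h q) p = pderiv i f p * h p + f p * pderiv i h p := by
  obtain ⟨v, rfl⟩ := proj_surjective p
  have := deriv_fun_mul (hasDerivAt_shift hf i v).differentiableAt
    (hasDerivAt_shift hh i v).differentiableAt
  simp only [shift_zero, add_zero] at this
  exact this

lemma hasDerivAt_translate {f : Torus → ℂ} (hf : IsSmooth f) (i : Fin 2) (p : Torus) (t : ℝ) :
    HasDerivAt (fun s : ℝ => f (p + shift i s)) (pderiv i f (p + shift i t)) t := by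
  obtain ⟨v, hv⟩ := proj_surjective (p + shift i t)
  have h := hasDerivAt_shift hf i v
  rw [← pderiv_proj hf, hv, ← sub_self t] at h
  refine (h.comp_sub_const t t).congr_of_eventuallyEq (.of_forall fun s => ?_)
  change _ = f (p + shift i t + shift i (s - t))
  rw [add_assoc, ← shift_add, add_sub_cancel]

lemma IsSmooth.integrable {f : Torus → ℂ} (hf : IsSmooth f) : Integrable f :=
  hf.continuous.integrable_of_hasCompactSupport (HasCompactSupport.of_compactSpace f)

/-- The integral of `f (p + t e_i)` over the torus does not depend on `t`, and its derivative
in `t` is the integral of `∂_i f`. -/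
lemma integral_pderiv {f : Torus → ℂ} (hf : IsSmooth f) (i : Fin 2) :
    ∫ p, pderiv i f p = 0 := by
  have hc := (hf.pderiv i).continuous
  obtain ⟨C, hC⟩ := isCompact_univ.exists_bound_of_continuousOn hc.continuousOn
  have key := (hasDerivAt_integral_of_dominated_loc_of_deriv_le (μ := (volume : Measure Torus))
    (F := fun (t : ℝ) p => f (p + shift i t)) (F' := fun t p => pderiv i f (p + shift i t))
    (x₀ := 0) (s := Set.univ) (bound := fun _ => C) Filter.univ_mem
    (.of_forall fun t =>
      (hf.continuous.comp (continuous_id.add continuous_const)).aestronglyMeasurable)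
    (by simpa only [shift_zero, add_zero] using hf.integrable)
    (by simpa only [shift_zero, add_zero] using hc.aestronglyMeasurable)
    (.of_forall fun p t _ => hC _ (Set.mem_univ _))
    (integrable_const C)
    (.of_forall fun p t _ => hasDerivAt_translate hf i p t)).2
  have hinv : (volume : Measure Torus).IsAddRightInvariant :=
    inferInstanceAs ((volume : Measure Circ).prod (volume : Measure Circ)).IsAddRightInvariant
  have hconst : ∀ t : ℝ, ∫ p, f (p + shift i t) = ∫ p, f p :=
    fun t => integral_add_right_eq_self f (shift i t)
  simp only [hconst, shift_zero, add_zero] at key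
  exact key.unique (hasDerivAt_const _ _)

lemma integral_mul_pderiv {f h : Torus → ℂ} (hf : IsSmooth f) (hh : IsSmooth h) (i : Fin 2) :
    ∫ p, f p * pderiv i h p = -∫ p, pderiv i f p * h p := by
  have h0 := integral_pderiv (hf.mul hh) i
  simp only [pderiv_mul hf hh] at h0
  rw [integral_add ((hf.pderiv i).mul hh).integrable (hf.mul (hh.pderiv i)).integrable] at h0
  linear_combination h0

lemma pderiv_comm {f : Torus → ℂ} (hf : IsSmooth f) (i j : Fin 2) (p : Torus) :
    pderiv i (pderiv j f) p = pderiv j (pderiv i f) p := by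
  obtain ⟨v, rfl⟩ := proj_surjective p
  have hF : ContDiff ℝ ∞ (fun w : ℝ × ℝ => f (proj w)) := hf
  have hd : DifferentiableAt ℝ (fderiv ℝ (fun w : ℝ × ℝ => f (proj w))) v :=
    (hF.fderiv_right (m := ∞) (by simp)).differentiable (by simp) v
  have e : ∀ i j, pderiv i (pderiv j f) (proj v) =
      fderiv ℝ (fderiv ℝ (fun w : ℝ × ℝ => f (proj w))) v (vec i) (vec j) := by
    intro i j
    rw [pderiv_proj (hf.pderiv j)]
    simp only [pderiv_proj hf]
    rw [fderiv_clm_apply hd (differentiableAt_const _)]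
    simp
  rw [e, e]
  have h2 : minSmoothness ℝ 2 ≤ ∞ := by
    simpa using WithTop.coe_le_coe.2 (le_top : (2 : ℕ∞) ≤ ⊤)
  exact (hF.contDiffAt.isSymmSndFDerivAt h2).eq _ _

/-! ### The wave operator of the metric -/

lemma smooth_sinMul (ℓ : ℤ) : IsSmooth (fun q : Torus => (sinMul ℓ q.1 : ℂ)) := by
  refine IsSmooth.ofReal (f := fun q => sinMul ℓ q.1) ?_
  unfold IsSmooth
  simp only [proj, sinMul_coe]
  fun_prop

lemma density_sinMetric (ℓ : ℤ) (ε : ℝ) (p : Torus) : (sinMetric ℓ ε).density p = 1 := by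
  simp [LorentzianMetric.density, sinMetric, Matrix.det_fin_two]

lemma inv_coeff_sinMetric (ℓ : ℤ) (ε : ℝ) (p : Torus) :
    ((sinMetric ℓ ε).coeff p)⁻¹ = !![ε * sinMul ℓ p.1, 1; 1, 0] := by
  refine Matrix.inv_eq_left_inv ?_
  ext i j
  fin_cases i <;> fin_cases j <;> simp [sinMetric, Matrix.mul_apply, Fin.sum_univ_two]

lemma laplaceBeltrami_sinMetric (ℓ : ℤ) (ε : ℝ) (f : SmoothFn) (p : Torus) :
    (laplaceBeltrami (sinMetric ℓ ε) f : Torus → ℂ) p =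
      (ε : ℂ) * pderiv 0 (fun q => (sinMul ℓ q.1 : ℂ) * pderiv 0 f q) p
        + 2 * pderiv 0 (pderiv 1 f) p := by
  have hf : IsSmooth (f : Torus → ℂ) := f.2
  have h0 : pderiv 1 (fun _ => (0 : ℂ)) p = 0 := by simp [pderiv]
  change lbExpr (sinMetric ℓ ε) f p = _
  simp only [lbExpr, density_sinMetric, inv_coeff_sinMetric, Fin.sum_univ_two]
  simp only [Matrix.of_apply, Matrix.cons_val_zero, Matrix.cons_val_one, one_mul,
    Complex.ofReal_mul, Complex.ofReal_one, Complex.ofReal_zero, zero_mul, inv_one, mul_assoc, h0,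
    pderiv_smul ((smooth_sinMul ℓ).mul (hf.pderiv 0)), Matrix.cons_val_fin_one, add_zero]
  rw [pderiv_comm hf 1 0, add_assoc, ← two_mul]

/-! ### Plane waves in the first variable -/

/-- The plane wave `e^{ikx}` on the torus. -/
noncomputable def wave (k : ℤ) (p : Torus) : ℂ := fourier k p.1

lemma smooth_wave (k : ℤ) : IsSmooth (wave k) := by
  unfold IsSmooth
  simp only [wave, proj, fourier_coe_apply]
  have h : ContDiff ℝ ∞ (fun v : ℝ × ℝ => (v.1 : ℂ)) :=
    Complex.ofRealCLM.contDiff.comp contDiff_fst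
  exact (((contDiff_const.mul h).div_const _)).cexp

lemma wave_add (j k : ℤ) (p : Torus) : wave (j + k) p = wave j p * wave k p := fourier_add

lemma wave_neg (k : ℤ) (p : Torus) : wave (-k) p = conj (wave k p) := fourier_neg

lemma wave_zero (p : Torus) : wave 0 p = 1 := fourier_zero

lemma pderiv_zero_wave (k : ℤ) (p : Torus) :
    pderiv 0 (wave k) p = Complex.I * k * wave k p := by
  obtain ⟨x, hx⟩ := QuotientAddGroup.mk_surjective p.1
  have h := hasDerivAt_fourier (2 * π) k x
  have e : (2 * π * Complex.I * k / ((2 * π : ℝ) : ℂ)) = Complex.I * k := by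
    have : (π : ℂ) ≠ 0 := by exact_mod_cast Real.pi_ne_zero
    push_cast
    field_simp
  rw [e] at h
  rw [← add_zero x] at h
  have h2 := (h.comp_const_add x 0).deriv
  simp only [add_zero, AddCircle.coe_add] at h2
  simp only [pderiv, wave, shift, Prod.fst_add, Matrix.cons_val_zero, ← hx]
  exact h2

lemma pderiv_one_wave (k : ℤ) (p : Torus) : pderiv 1 (wave k) p = 0 := by
  simp [pderiv, wave, shift]

lemma sinMul_eq_wave (ℓ : ℤ) (p : Torus) :
    (sinMul ℓ p.1 : ℂ) = (wave ℓ p - wave (-ℓ) p) / (2 * Complex.I) := by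
  obtain ⟨v, rfl⟩ := proj_surjective p
  have : (π : ℂ) ≠ 0 := by exact_mod_cast Real.pi_ne_zero
  simp only [wave, proj, sinMul_coe, fourier_coe_apply, Complex.ofReal_sin, Complex.sin]
  have e : ∀ m : ℤ, 2 * π * Complex.I * m * v.1 / ((2 * π : ℝ) : ℂ) = m * v.1 * Complex.I := by
    intro m
    push_cast
    field_simp
  rw [e, e]
  push_cast
  rw [div_eq_div_iff two_ne_zero (by simp)]
  ring_nf
  simp only [Complex.I_sq]
  ring_nf

/-! ### Fourier coefficients in the first variable -/

/-- The integral of `e^{ikx} f` over the torus, a Fourier coefficient of `f` up to normalization. -/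
noncomputable def waveIntegral (k : ℤ) (f : Torus → ℂ) : ℂ := ∫ p, wave k p * f p

lemma waveIntegral_pderiv_zero {f : Torus → ℂ} (hf : IsSmooth f) (k : ℤ) :
    waveIntegral k (pderiv 0 f) = -(Complex.I * k * waveIntegral k f) := by
  unfold waveIntegral
  rw [integral_mul_pderiv (smooth_wave k) hf]
  simp only [pderiv_zero_wave, mul_assoc, integral_const_mul]

lemma waveIntegral_pderiv_one {f : Torus → ℂ} (hf : IsSmooth f) (k : ℤ) :
    waveIntegral k (pderiv 1 f) = 0 := by
  unfold waveIntegral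
  rw [integral_mul_pderiv (smooth_wave k) hf]
  simp only [pderiv_one_wave, zero_mul, integral_zero, neg_zero]

lemma waveIntegral_add {f h : Torus → ℂ} (hf : IsSmooth f) (hh : IsSmooth h) (k : ℤ) :
    waveIntegral k (fun p => f p + h p) = waveIntegral k f + waveIntegral k h := by
  simp only [waveIntegral, mul_add]
  exact integral_add ((smooth_wave k).mul hf).integrable ((smooth_wave k).mul hh).integrable

lemma waveIntegral_const_mul (c : ℂ) (f : Torus → ℂ) (k : ℤ) :
    waveIntegral k (fun p => c * f p) = c * waveIntegral k f := by
  simp only [waveIntegral, mul_left_comm _ c, integral_const_mul]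

lemma waveIntegral_sinMul_mul {f : Torus → ℂ} (hf : IsSmooth f) (ℓ k : ℤ) :
    waveIntegral k (fun p => (sinMul ℓ p.1 : ℂ) * f p) =
      (waveIntegral (k + ℓ) f - waveIntegral (k - ℓ) f) / (2 * Complex.I) := by
  unfold waveIntegral
  rw [← integral_sub ((smooth_wave _).mul hf).integrable ((smooth_wave _).mul hf).integrable,
    ← integral_div]
  congr 1 with p
  simp only [sinMul_eq_wave, sub_eq_add_neg k, wave_add]
  ring

/-- On Fourier coefficients in `x`, the wave operator is a two-sided weighted shift: the
coefficient of order `k` of `□_g φ` involves only those of `φ` of orders `k + ℓ` and `k - ℓ`. -/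
lemma waveIntegral_laplaceBeltrami (ℓ : ℤ) (ε : ℝ) (φ : SmoothFn) (k : ℤ) :
    waveIntegral k (laplaceBeltrami (sinMetric ℓ ε) φ : Torus → ℂ) =
      Complex.I * k * ε / 2 * ((k + ℓ) * waveIntegral (k + ℓ) (φ : Torus → ℂ)
        - (k - ℓ) * waveIntegral (k - ℓ) (φ : Torus → ℂ)) := by
  have hφ : IsSmooth (φ : Torus → ℂ) := φ.2
  have hs := (smooth_sinMul ℓ).mul (hφ.pderiv 0)
  have e : (laplaceBeltrami (sinMetric ℓ ε) φ : Torus → ℂ) = fun p =>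
      (ε : ℂ) * pderiv 0 (fun q => (sinMul ℓ q.1 : ℂ) * pderiv 0 φ q) p
        + 2 * pderiv 0 (pderiv 1 φ) p :=
    funext (laplaceBeltrami_sinMetric ℓ ε φ)
  rw [e, waveIntegral_add ((hs.pderiv 0).const_mul _) (((hφ.pderiv 1).pderiv 0).const_mul _),
    waveIntegral_const_mul, waveIntegral_const_mul, waveIntegral_pderiv_zero hs,
    waveIntegral_pderiv_zero (hφ.pderiv 1), waveIntegral_pderiv_one hφ,
    waveIntegral_sinMul_mul (hφ.pderiv 0), waveIntegral_pderiv_zero hφ,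
    waveIntegral_pderiv_zero hφ]
  push_cast
  field_simp
  ring

lemma norm_wave (k : ℤ) (p : Torus) : ‖wave k p‖ = 1 := by
  rw [wave, fourier_apply, Circle.norm_coe]

lemma norm_waveIntegral_le (k : ℤ) (f : Torus → ℂ) : ‖waveIntegral k f‖ ≤ ∫ p, ‖f p‖ := by
  refine (norm_integral_le_integral_norm _).trans_eq ?_
  simp only [norm_mul, norm_wave, one_mul]

/-- The decay of the Fourier coefficients that makes the boundary terms of the summation by
parts vanish; it comes from two integrations by parts. -/
lemma tendsto_mul_waveIntegral {f : Torus → ℂ} (hf : IsSmooth f) {ℓ : ℤ} (hℓ : ℓ ≠ 0) :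
    Filter.Tendsto (fun n : ℕ => (n : ℂ) * waveIntegral (n * ℓ) f) Filter.atTop (nhds 0) := by
  have hℓ' : (ℓ : ℂ) ≠ 0 := by exact_mod_cast hℓ
  rw [← Filter.tendsto_add_atTop_iff_nat 1]
  have h1 : Filter.Tendsto (fun n : ℕ => (1 / ((n : ℝ) + 1)) *
      ((∫ p, ‖pderiv 0 (pderiv 0 f) p‖) / ‖(ℓ : ℂ)‖ ^ 2)) Filter.atTop (nhds 0) := by
    simpa only [zero_mul] using (tendsto_one_div_add_atTop_nhds_zero_nat (𝕜 := ℝ)).mul_const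
      ((∫ p, ‖pderiv 0 (pderiv 0 f) p‖) / ‖(ℓ : ℂ)‖ ^ 2)
  refine squeeze_zero_norm (fun n => ?_) h1
  have h2 := norm_waveIntegral_le ((n + 1 : ℕ) * ℓ) (pderiv 0 (pderiv 0 f))
  rw [waveIntegral_pderiv_zero (hf.pderiv 0), waveIntegral_pderiv_zero hf] at h2
  have hn : ‖((n + 1 : ℕ) : ℂ)‖ = (n : ℝ) + 1 := by
    rw [Complex.norm_natCast]
    push_cast
    rfl
  push_cast at h2 hn ⊢
  simp only [norm_neg, norm_mul, Complex.norm_I, one_mul, hn] at h2 ⊢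
  rw [one_div, inv_mul_eq_div, le_div_iff₀ (by positivity), le_div_iff₀ (by positivity)]
  calc _ = _ := by ring
    _ ≤ _ := h2

/-! ### The recurrence for the amplitudes -/

/-- The solution `d` of `d_{n+1} = d_{n-1} - d_n / (K n²)` with `d_0 = 0` and `d_1 = 1`. -/
noncomputable def amp (K : ℝ) : ℕ → ℝ
  | 0 => 0
  | 1 => 1
  | n + 2 => amp K n - amp K (n + 1) / (K * (n + 1) ^ 2)

/-- The solutions of the recurrence are bounded, since it is a summable perturbation of
`d_{n+1} = d_{n-1}`. -/
lemma exists_abs_amp_le (K : ℝ) : ∃ C, ∀ n, |amp K n| ≤ C := by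
  set a : ℕ → ℝ := fun k => |K|⁻¹ * (1 / ((k : ℝ) + 1) ^ 2)
  have ha0 : ∀ k, 0 ≤ a k := fun k => by positivity
  have ha : Summable a := by
    refine Summable.mul_left _ ?_
    exact_mod_cast (summable_nat_add_iff 1).2 (Real.summable_one_div_nat_pow.2 one_lt_two)
  have key : ∀ n, |amp K n| + |amp K (n + 1)| ≤ Real.exp (∑ k ∈ Finset.range n, a k) := by
    intro n
    induction n with
    | zero => simp [amp]
    | succ n ih =>
      have h1 : |amp K (n + 2)| ≤ |amp K n| + a n * |amp K (n + 1)| := by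
        rw [amp]
        refine (abs_sub _ _).trans_eq ?_
        rw [abs_div, abs_mul, abs_of_nonneg (sq_nonneg ((n : ℝ) + 1))]
        simp only [a]
        rw [div_eq_mul_inv, mul_inv]
        ring
      rw [Finset.sum_range_succ, Real.exp_add]
      calc |amp K (n + 1)| + |amp K (n + 2)|
          ≤ (|amp K n| + |amp K (n + 1)|) * (a n + 1) := by
            nlinarith [mul_nonneg (ha0 n) (abs_nonneg (amp K n))]
        _ ≤ _ := mul_le_mul ih (Real.add_one_le_exp _) (by linarith [ha0 n]) (Real.exp_nonneg _)
  refine ⟨Real.exp (∑' k, a k), fun n => ?_⟩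
  calc |amp K n| ≤ |amp K n| + |amp K (n + 1)| := le_add_of_nonneg_right (abs_nonneg _)
    _ ≤ _ := key n
    _ ≤ _ := Real.exp_le_exp.2 (ha.sum_le_tsum _ fun k _ => ha0 k)

/-- Summation by parts against the recurrence leaves only boundary terms. -/
lemma sum_amp_eq {K : ℝ} (hK : K ≠ 0) (A : ℕ → ℂ) (N : ℕ) :
    ∑ n ∈ Finset.range N, ((amp K (n + 1) / (n + 1 : ℕ) : ℝ) : ℂ) *
        (Complex.I * (K * (n + 1) * ((n + 2) * A (n + 2) - n * A n) - A (n + 1))) =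
      Complex.I * K * (amp K N * (((N + 1 : ℕ) : ℂ) * A (N + 1)) + amp K (N + 1) * (N * A N)) := by
  have hK' : (K : ℂ) ≠ 0 := by exact_mod_cast hK
  induction N with
  | zero => simp [amp]
  | succ N ih =>
    have hN : (N : ℂ) + 1 ≠ 0 := by exact_mod_cast N.succ_ne_zero
    rw [Finset.sum_range_succ, ih, amp]
    push_cast
    field_simp
    ring

/-! ### Non-self-adjointness from an imaginary eigenvalue of the adjoint -/

lemma not_isSelfAdjoint_of_range_orthogonal {H : Type} [NormedAddCommGroup H]
    [InnerProductSpace ℂ H] [CompleteSpace H] {S : H →ₗ.[ℂ] H} {v : H} (hv : v ≠ 0)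
    (h : ∀ x : S.domain, inner ℂ v (S x) = Complex.I * inner ℂ v (x : H)) :
    ¬ IsSelfAdjoint S := by
  intro hS
  have h1 : ∀ x : S.domain, inner ℂ (-Complex.I • v) (x : H) = inner ℂ v (S x) := by
    intro x
    rw [h, inner_smul_left]
    simp
  have hmem := S.mem_adjoint_domain_of_exists v ⟨_, h1⟩
  have happ : S.adjoint ⟨v, hmem⟩ = -Complex.I • v :=
    LinearPMap.adjoint_apply_eq hS.dense_domain ⟨v, hmem⟩ h1
  -- If `S† = S`, then `v` is an eigenvector of `S` itself. The equation `S† = S` is used through a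
  -- variable `T`, since the domain of `S†` occurs in the type of its argument.
  have key : ∀ T : H →ₗ.[ℂ] H, T = S → ∀ hm : v ∈ T.domain, T ⟨v, hm⟩ = -Complex.I • v →
      False := by
    rintro T rfl hm hT
    have h2 := h ⟨v, hm⟩
    rw [hT, inner_smul_right] at h2
    have h3 : (2 * Complex.I) * inner ℂ v v = 0 := by linear_combination -h2
    exact hv (inner_self_eq_zero.1 ((mul_eq_zero.1 h3).resolve_left (by simp)))
  exact key _ (LinearPMap.isSelfAdjoint_def.1 hS) hmem happ

/-- If the range of `T - i` has a nonzero vector in its orthogonal complement, then so has the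
range of the closure of `T` minus `i`, which is therefore not self-adjoint. -/
lemma not_isEssentiallySelfAdjoint_of_range_orthogonal {H : Type} [NormedAddCommGroup H]
    [InnerProductSpace ℂ H] [CompleteSpace H] {T : H →ₗ.[ℂ] H} {v : H} (hv : v ≠ 0)
    (h : ∀ x : T.domain, inner ℂ v (T x) = Complex.I * inner ℂ v (x : H)) :
    ¬ IsEssentiallySelfAdjoint T := by
  by_cases hT : T.IsClosable
  · refine not_isSelfAdjoint_of_range_orthogonal hv fun x => ?_
    have hx : ((x : H), T.closure x) ∈ _root_.closure (T.graph : Set (H × H)) := by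
      have := T.closure.mem_graph x
      rw [← hT.graph_closure_eq_closure_graph] at this
      exact this
    have hcl : IsClosed {q : H × H | inner ℂ v q.2 = Complex.I * inner ℂ v q.1} :=
      isClosed_eq (by fun_prop) (by fun_prop)
    refine closure_minimal ?_ hcl hx
    rintro ⟨a, b⟩ hab
    obtain ⟨y, hy1, hy2⟩ := T.mem_graph_iff.1 hab
    change inner ℂ v b = Complex.I * inner ℂ v a
    simp only at hy1 hy2
    rw [← hy1, ← hy2, h y]
  · unfold IsEssentiallySelfAdjoint
    rw [LinearPMap.closure_def' hT]
    exact not_isSelfAdjoint_of_range_orthogonal hv h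

/-! ### Plane waves in `L²` -/

lemma integral_wave {k : ℤ} (hk : k ≠ 0) : ∫ p, wave k p = 0 := by
  have h := integral_pderiv (smooth_wave k) 0
  simp only [pderiv_zero_wave, integral_const_mul] at h
  exact (mul_eq_zero.1 h).resolve_left (by simp [hk])

lemma integral_one : ∫ _ : Torus, (1 : ℂ) = ((2 * π) ^ 2 : ℝ) := by
  have h : (volume : Measure Torus) Set.univ = ENNReal.ofReal (2 * π) * ENNReal.ofReal (2 * π) := by
    rw [← Set.univ_prod_univ]
    change ((volume : Measure Circ).prod (volume : Measure Circ)) _ = _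
    rw [Measure.prod_prod, AddCircle.measure_univ]
  simp only [integral_const, Measure.real, h, ENNReal.toReal_mul,
    ENNReal.toReal_ofReal Real.two_pi_pos.le]
  simp
  ring

/-- The normalized plane wave `e^{i(n+1)ℓx} / (2π)` as an element of `L²`. -/
noncomputable def waveL2 (ℓ : ℤ) (n : ℕ) : L2 :=
  toL2 (((2 * π : ℝ) : ℂ)⁻¹ • ⟨wave ((n + 1 : ℕ) * ℓ), smooth_wave _⟩)

lemma inner_toL2 (f h : SmoothFn) :
    inner ℂ (toL2 f) (toL2 h) = ∫ p, (h : Torus → ℂ) p * conj ((f : Torus → ℂ) p) :=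
  ContinuousMap.inner_toLp volume (toContinuous f) (toContinuous h)

lemma orthonormal_waveL2 {ℓ : ℤ} (hℓ : ℓ ≠ 0) : Orthonormal ℂ (waveL2 ℓ) := by
  rw [orthonormal_iff_ite]
  intro i j
  have hπ : ((2 * π : ℝ) : ℂ) ≠ 0 := by exact_mod_cast Real.two_pi_pos.ne'
  have h : inner ℂ (waveL2 ℓ i) (waveL2 ℓ j) =
      ((2 * π : ℝ) : ℂ)⁻¹ ^ 2 * ∫ p, wave (((j : ℤ) - i) * ℓ) p := by
    rw [waveL2, waveL2, inner_toL2, ← integral_const_mul]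
    congr 1 with p
    have e : ((j : ℤ) - i) * ℓ = (j + 1 : ℕ) * ℓ + -((i + 1 : ℕ) * ℓ) := by
      push_cast
      ring
    rw [e, wave_add, wave_neg]
    simp only [Submodule.coe_smul, Pi.smul_apply, smul_eq_mul, map_mul, map_inv₀,
      Complex.conj_ofReal]
    ring
  rw [h]
  split_ifs with hij
  · subst hij
    simp only [sub_self, zero_mul, wave_zero, integral_one]
    push_cast at hπ ⊢
    field_simp
  · rw [integral_wave (mul_ne_zero (sub_ne_zero.2 fun h => hij (by exact_mod_cast h.symm)) hℓ),
      mul_zero]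

/-- The bilinear pairing of `L²` with a smooth function is continuous: it is the inner product
with the conjugate function. -/
lemma exists_pairing (ψ : SmoothFn) :
    ∃ L : L2 →L[ℂ] ℂ, (∀ w : L2, L w = ∫ p, w p * (ψ : Torus → ℂ) p) ∧
      ∀ f : SmoothFn, L (toL2 f) = ∫ p, (f : Torus → ℂ) p * (ψ : Torus → ℂ) p := by
  have hψ : IsSmooth (fun p => conj ((ψ : Torus → ℂ) p)) :=
    Complex.conjCLE.contDiff.comp (show ContDiff ℝ ∞ _ from ψ.2)
  let χ : SmoothFn := ⟨fun p => conj ((ψ : Torus → ℂ) p), hψ⟩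
  refine ⟨innerSL ℂ (toL2 χ), fun w => ?_, fun f => ?_⟩
  · rw [innerSL_apply_apply, L2.inner_def]
    refine integral_congr_ae ?_
    have h := ContinuousMap.coeFn_toLp (p := 2) (𝕜 := ℂ) (volume : Measure Torus)
      (toContinuous χ)
    filter_upwards [h] with p hp
    change inner ℂ ((ContinuousMap.toLp 2 volume ℂ (toContinuous χ) : L2) p) (w p) = _
    rw [hp]
    simp [toContinuous, χ]
  · rw [innerSL_apply_apply, inner_toL2]
    simp [χ]

/-! ### The weak eigenfunction -/

/-- The series `∑_{n ≥ 1} (d_n / n) e^{inℓx}`, with `d = amp (ε ℓ² / 2)`, is a weak solution. -/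
lemma exists_isWeakEigenfunction {ℓ : ℤ} (hℓ : ℓ ≠ 0) {ε : ℝ} (hε : ε ≠ 0) :
    ∃ w : L2, w ≠ 0 ∧ IsWeakEigenfunction (sinMetric ℓ ε) Complex.I w := by
  set K : ℝ := ε * (ℓ : ℝ) ^ 2 / 2 with hKdef
  have hK : K ≠ 0 := by
    have : (ℓ : ℝ) ≠ 0 := by exact_mod_cast hℓ
    positivity
  obtain ⟨C, hC⟩ := exists_abs_amp_le K
  set c : ℕ → ℂ := fun n => ((amp K (n + 1) / (n + 1 : ℕ) : ℝ) : ℂ) with hc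
  have hv := orthonormal_waveL2 hℓ
  have hsum : Summable fun n => c n • waveL2 ℓ n := by
    have h := (hv.orthogonalFamily.summable_iff_norm_sq_summable c).2 ?_
    · simpa using h
    refine Summable.of_nonneg_of_le (fun n => by positivity) (fun n => ?_)
      (((summable_nat_add_iff 1).2 (Real.summable_one_div_nat_pow.2 one_lt_two)).mul_left (C ^ 2))
    simp only [hc, Complex.norm_real, Real.norm_eq_abs, abs_div, div_pow, Nat.abs_cast]
    rw [mul_one_div]
    gcongr
    exact hC _
  refine ⟨∑' n, c n • waveL2 ℓ n, fun h0 => ?_, fun φ => ?_⟩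
  · have h1 := (hsum.hasSum.mapL (innerSL ℂ (waveL2 ℓ 0))).tsum_eq
    rw [h0, map_zero] at h1
    simp only [innerSL_apply_apply, inner_smul_right, orthonormal_iff_ite.1 hv] at h1
    simp [hc, amp] at h1
  · have hφ : IsSmooth (φ : Torus → ℂ) := φ.2
    set ψ : SmoothFn := laplaceBeltrami (sinMetric ℓ ε) φ - Complex.I • φ with hψ
    obtain ⟨L, hL, hLs⟩ := exists_pairing ψ
    have hgoal : ∀ w : L2, ∫ p : Torus, w p *
        ((laplaceBeltrami (sinMetric ℓ ε) φ : Torus → ℂ) p - Complex.I * (φ : Torus → ℂ) p)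
          * ((sinMetric ℓ ε).density p : ℂ) = L w := by
      intro w
      rw [hL]
      simp [density_sinMetric, hψ]
    rw [hgoal]
    set A : ℕ → ℂ := fun n => waveIntegral (n * ℓ) (φ : Torus → ℂ) with hA
    have hterm : ∀ n, L (c n • waveL2 ℓ n) = ((2 * π : ℝ) : ℂ)⁻¹ * (c n *
        (Complex.I * (K * (n + 1) * ((n + 2) * A (n + 2) - n * A n) - A (n + 1)))) := by
      intro n
      have h1 : waveIntegral ((n + 1 : ℕ) * ℓ) (ψ : Torus → ℂ) =
          Complex.I * (K * (n + 1) * ((n + 2) * A (n + 2) - n * A n) - A (n + 1)) := by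
        have e : (ψ : Torus → ℂ) = fun p => (laplaceBeltrami (sinMetric ℓ ε) φ : Torus → ℂ) p +
            -Complex.I * (φ : Torus → ℂ) p := by
          ext p
          simp [hψ, sub_eq_add_neg]
        have e1 : (((n + 1 : ℕ) : ℤ) * ℓ + ℓ) = (n + 2 : ℕ) * ℓ := by
          push_cast
          ring
        have e2 : (((n + 1 : ℕ) : ℤ) * ℓ - ℓ) = n * ℓ := by
          push_cast
          ring
        rw [e, waveIntegral_add (laplaceBeltrami (sinMetric ℓ ε) φ).2
          (hφ.const_mul _), waveIntegral_const_mul,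
          waveIntegral_laplaceBeltrami, e1, e2]
        simp only [hA, hKdef]
        push_cast
        ring
      rw [map_smul, waveL2, map_smul, map_smul, hLs, ← h1]
      simp only [smul_eq_mul, waveIntegral]
      ring
    have hS := (hsum.hasSum.mapL L).tendsto_sum_nat
    -- The pairing with the partial sums is reduced to boundary terms, which tend to `0`.
    have hpartial : ∀ N, ∑ n ∈ Finset.range N, L (c n • waveL2 ℓ n) = _ := fun N =>
      (Finset.sum_congr rfl fun n _ => hterm n).trans
        ((Finset.mul_sum _ _ _).symm.trans (congrArg _ (sum_amp_eq hK A N)))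
    simp only [hpartial] at hS
    have hB : Filter.Tendsto (fun n : ℕ => (n : ℂ) * A n) Filter.atTop (nhds 0) :=
      tendsto_mul_waveIntegral hφ hℓ
    have hbdd : ∀ (m : ℕ → ℕ) (b : ℕ → ℂ), Filter.Tendsto b Filter.atTop (nhds 0) →
        Filter.Tendsto (fun n => (amp K (m n) : ℂ) * b n) Filter.atTop (nhds 0) := by
      intro m b hb
      refine squeeze_zero_norm (a := fun n => C * ‖b n‖) (fun n => ?_) ?_
      · rw [norm_mul, Complex.norm_real, Real.norm_eq_abs]
        exact mul_le_mul_of_nonneg_right (hC _) (norm_nonneg _)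
      · simpa using hb.norm.const_mul C
    have h0 := ((hbdd (fun n => n) _ ((Filter.tendsto_add_atTop_iff_nat 1).2 hB)).add
      (hbdd (fun n => n + 1) _ hB)).const_mul (Complex.I * K) |>.const_mul ((2 * π : ℝ) : ℂ)⁻¹
    simp only [add_zero, mul_zero] at h0
    exact tendsto_nhds_unique hS h0

/-- The weak equation says that the complex conjugate of `w` is orthogonal to the range of
`□_g - i` on smooth functions. -/
lemma not_isEssentiallySelfAdjoint_of_isWeakEigenfunction {ℓ : ℤ} {ε : ℝ} {w : L2} (hw : w ≠ 0)
    (h : IsWeakEigenfunction (sinMetric ℓ ε) Complex.I w) :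
    ¬ IsEssentiallySelfAdjoint (smoothOperator (laplaceBeltrami (sinMetric ℓ ε))) := by
  have hpair : ∀ ψ : SmoothFn,
      inner ℂ (star w) (toL2 ψ) = ∫ p, w p * (ψ : Torus → ℂ) p := by
    intro ψ
    rw [L2.inner_def]
    refine integral_congr_ae ?_
    have h1 := ContinuousMap.coeFn_toLp (p := 2) (𝕜 := ℂ) (volume : Measure Torus)
      (toContinuous ψ)
    filter_upwards [h1, Lp.coeFn_star w] with p hp hs
    change inner ℂ ((star w : L2) p) ((ContinuousMap.toLp 2 volume ℂ (toContinuous ψ) : L2) p) = _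
    rw [hp, hs]
    simp [toContinuous, mul_comm]
  have hstar : star w ≠ 0 := by
    intro h0
    refine hw (Lp.eq_zero_iff_ae_eq_zero.2 ?_)
    filter_upwards [Lp.eq_zero_iff_ae_eq_zero.1 h0, Lp.coeFn_star w] with p hp hs
    rw [hs] at hp
    simpa using hp
  refine not_isEssentiallySelfAdjoint_of_range_orthogonal hstar ?_
  rintro ⟨_, φ, rfl⟩
  have hT : smoothOperator (laplaceBeltrami (sinMetric ℓ ε)) ⟨toL2 φ, φ, rfl⟩ =
      toL2 (laplaceBeltrami (sinMetric ℓ ε) φ) := by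
    have : (LinearEquiv.ofInjective toL2 toL2_injective).symm ⟨toL2 φ, φ, rfl⟩ = φ :=
      (LinearEquiv.ofInjective toL2 toL2_injective).symm_apply_apply φ
    change toL2 (laplaceBeltrami (sinMetric ℓ ε)
      ((LinearEquiv.ofInjective toL2 toL2_injective).symm ⟨toL2 φ, φ, rfl⟩)) = _
    rw [this]
  have h1 := hpair (laplaceBeltrami (sinMetric ℓ ε) φ - Complex.I • φ)
  have h2 := h φ
  simp only [density_sinMetric, Complex.ofReal_one, mul_one] at h2
  have h3 : inner ℂ (star w) (toL2 (laplaceBeltrami (sinMetric ℓ ε) φ)) -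
      Complex.I * inner ℂ (star w) (toL2 φ) = 0 := by
    rw [map_sub, map_smul, inner_sub_right, inner_smul_right] at h1
    exact h1.trans h2
  rw [hT]
  exact sub_eq_zero.1 h3

end LorentzTorus

theorem mainTheorem3 (ℓ : ℤ) (hℓ : ℓ ≠ 0) (ε : ℝ) (hε : ε ≠ 0) :
    -- the volume density of `g` is that of `dx dy`
    (∀ p, (LorentzTorus.sinMetric ℓ ε).density p = 1) ∧
    -- `□_g = ε ∂_x (sin(ℓ x) ∂_x) + 2 ∂_x ∂_y` on smooth functions
    (∀ (f : LorentzTorus.SmoothFn) (p : LorentzTorus.Torus),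
      (LorentzTorus.laplaceBeltrami (LorentzTorus.sinMetric ℓ ε) f : LorentzTorus.Torus → ℂ) p =
        (ε : ℂ) * LorentzTorus.pderiv 0
            (fun q => (LorentzTorus.sinMul ℓ q.1 : ℂ) * LorentzTorus.pderiv 0 f q) p
          + 2 * LorentzTorus.pderiv 0 (LorentzTorus.pderiv 1 f) p) ∧
    -- `□_g` is not essentially self-adjoint on `C^∞(𝕋²)`
    ¬ LorentzTorus.IsEssentiallySelfAdjoint
        (LorentzTorus.smoothOperator
          (LorentzTorus.laplaceBeltrami (LorentzTorus.sinMetric ℓ ε))) ∧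
    -- there is a nonzero `L²` solution of `(□_g - i) w = 0`
    ∃ w : LorentzTorus.L2, w ≠ 0 ∧
      LorentzTorus.IsWeakEigenfunction (LorentzTorus.sinMetric ℓ ε) Complex.I w := by
  obtain ⟨w, hw, h⟩ := LorentzTorus.exists_isWeakEigenfunction hℓ hε
  exact ⟨LorentzTorus.density_sinMetric ℓ ε, LorentzTorus.laplaceBeltrami_sinMetric ℓ ε,
    LorentzTorus.not_isEssentiallySelfAdjoint_of_isWeakEigenfunction hw h, w, hw, h⟩
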